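/- Let $n\ge 1$ and let $\mathcal{C}_n$ be the half-cylinder with $n$ marked points, i.e. the annulus with $n$ marked points on one of its boundary components. The marked points of its universal cover $\overline{\mathcal{C}}_n$ are identified with $\mathbb{Z}$, the deck transformations being the translations by multiples of $n$. An edge $[u,v]$ of $\overline{\mathcal{C}}_n$ is the isotopy class of curves joining two distinct marked points $u,v\in\mathbb{Z}$, and its length is $|v-u|$. Two edges $[a,b]$ and $[c,d]$ with $a<b$ and $c<d$ intersect if $a<c<b<d$ or $c<a<d<b$. An $m$-crossing is a set of $m$ pairwise intersecting edges. A $2$-star of $\overline{\mathcal{C}}_n$ is given by five vertices $z_0<z_1<z_2<z_3<z_4$ and has the five edges $[z_i,z_{i+2}]$, with indices modulo $5$. The edges and the $2$-stars of $\mathcal{C}_n$ are the projections of those of $\overline{\mathcal{C}}_n$, i.e. their classes under translation by multiples of $n$; an edge of $\mathcal{C}_n$ has the length of its lifts, and it is $2$-relevant if its length $\ell$ satisfies $2<\ell\le 2n$. A $2$-triangulation on $\mathcal{C}_n$ is an inclusion-maximal set $T$ of edges of $\mathcal{C}_n$ whose full preimage in $\overline{\mathcal{C}}_n$ contains no $3$-crossing;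 it contains a $2$-star if it contains all edges of that star. Then every $2$-triangulation on $\mathcal{C}_n$ contains exactly $n-1$ $2$-stars, exactly $2(n-1)$ $2$-relevant edges, and exactly $2(2n-1)$ edges in total. -/

import Mathlib

/-!
The half-cylinder `C_n` is an annulus with `n` marked points on one boundary component. Its universal
cover is a half-plane whose marked points, on the boundary line, are indexed by `ℤ`; the deck
transformations are the translations by the multiples of `n`.
-/

namespace HalfCylinder

/-- An edge `[u, v]` of the universal cover: the isotopy class of curves joining two distinct marked
points, recorded by its two endpoints in increasing order. -/
@[ext]
structure CoverEdge where
  lo : ℤ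
  hi : ℤ
  lo_lt_hi : lo < hi

namespace CoverEdge

/-- The edge `e` joins the marked points `u` and `v`, i.e. `e = [u, v]`. -/
def Joins (e : CoverEdge) (u v : ℤ) : Prop :=
  (e.lo = u ∧ e.hi = v) ∨ (e.lo = v ∧ e.hi = u)

/-- The length `|v - u|` of the edge `[u, v]`. -/
def length (e : CoverEdge) : ℤ := e.hi - e.lo

/-- The translate `e + t`. -/
def shift (e : CoverEdge) (t : ℤ) : CoverEdge :=
  ⟨e.lo + t, e.hi + t, add_lt_add_left e.lo_lt_hi t⟩

/-- Two edges intersect: their endpoints are distinct and alternate. -/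
def Crosses (e f : CoverEdge) : Prop :=
  (e.lo < f.lo ∧ f.lo < e.hi ∧ e.hi < f.hi) ∨ (f.lo < e.lo ∧ e.lo < f.hi ∧ f.hi < e.hi)

/-- Two edges of the cover are identified when one is a translation of the other by a multiple
of `n`. -/
def translationSetoid (n : ℕ) : Setoid CoverEdge where
  r e f := ∃ l : ℤ, f = e.shift (l * n)
  iseqv :=
    { refl := fun e => ⟨0, by ext <;> simp [shift]⟩
      symm := by
        rintro e f ⟨l, rfl⟩
        exact ⟨-l, by ext <;> simp [shift]⟩
      trans := by
        rintro e f g ⟨l, rfl⟩ ⟨m, rfl⟩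
        exact ⟨l + m, by ext <;> simp only [shift] <;> ring⟩ }

end CoverEdge

/-- A set `E` of edges of the cover is an `m`-crossing: `m` edges that pairwise intersect. -/
def IsCrossing (m : ℕ) (E : Finset CoverEdge) : Prop :=
  E.card = m ∧ (E : Set CoverEdge).Pairwise CoverEdge.Crosses

/-- A set of edges of the cover contains no `m`-crossing. -/
def CrossingFree (m : ℕ) (A : Set CoverEdge) : Prop :=
  ∀ E : Finset CoverEdge, (E : Set CoverEdge) ⊆ A → ¬ IsCrossing m E

/-- The edges of `C_n`: translation classes of edges of the universal cover. -/
def Edge (n : ℕ) : Type := Quotient (CoverEdge.translationSetoid n)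

/-- The covering map on edges. -/
def projEdge (n : ℕ) (e : CoverEdge) : Edge n :=
  Quotient.mk (CoverEdge.translationSetoid n) e

/-- The length of an edge of `C_n` is the length of any of its lifts. -/
def Edge.length {n : ℕ} (c : Edge n) : ℤ :=
  Quotient.lift CoverEdge.length
    (by rintro e f ⟨l, rfl⟩; simp [CoverEdge.length, CoverEdge.shift]) c

/-- An edge of `C_n` is `k`-relevant if its length `ℓ` satisfies `k < ℓ ≤ k n`. -/
def Edge.IsRelevant {n : ℕ} (k : ℕ) (c : Edge n) : Prop :=
  (k : ℤ) < c.length ∧ c.length ≤ (k : ℤ) * n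

/-- A `k`-triangulation on `C_n`: a maximal set of edges whose lift to the universal cover contains no
`(k + 1)`-crossing. -/
def IsTriangulation (n k : ℕ) (T : Set (Edge n)) : Prop :=
  Maximal (fun A : Set (Edge n) => CrossingFree (k + 1) (projEdge n ⁻¹' A)) T

/-- A `k`-star of the universal cover, given by its `2k + 1` vertices `z_0 < z_1 < ⋯ < z_{2k}`.
(Listing the vertices in cyclic order from another starting vertex gives the same star.) -/
@[ext]
structure CoverStar (k : ℕ) where
  z : Fin (2 * k + 1) → ℤ
  strictMono : StrictMono z

namespace CoverStar

/-- The edges `[z_i, z_{i+k}]` of a `k`-star, with indices modulo `2k + 1`. -/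
def edges {k : ℕ} (S : CoverStar k) : Set CoverEdge :=
  {e | ∃ i : Fin (2 * k + 1), e.Joins (S.z i) (S.z (Fin.ofNat (2 * k + 1) (i + k)))}

/-- The translate `S + t`. -/
def shift {k : ℕ} (S : CoverStar k) (t : ℤ) : CoverStar k :=
  ⟨fun i => S.z i + t, fun _ _ h => add_lt_add_left (S.strictMono h) t⟩

/-- Two stars of the cover are identified when one is a translation of the other by a multiple
of `n`. -/
def translationSetoid (n k : ℕ) : Setoid (CoverStar k) where
  r S R := ∃ l : ℤ, R = S.shift (l * n)
  iseqv :=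
    { refl := fun S => ⟨0, by ext; simp [shift]⟩
      symm := by
        rintro S R ⟨l, rfl⟩
        exact ⟨-l, by ext; simp [shift]⟩
      trans := by
        rintro S R Q ⟨l, rfl⟩ ⟨m, rfl⟩
        exact ⟨l + m, by ext; simp only [shift]; ring⟩ }

end CoverStar

/-- The `k`-stars of `C_n`: projections of `k`-stars of the universal cover, two of which have the same
projection when they are translations of each other. -/
def Star (n k : ℕ) : Type := Quotient (CoverStar.translationSetoid n k)

/-- The projection of a `k`-star of the universal cover. -/
def projStar (n : ℕ) {k : ℕ} (S : CoverStar k) : Star n k :=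
  Quotient.mk (CoverStar.translationSetoid n k) S

/-- The edges of a `k`-star of `C_n` are the projections of the edges of its lifts. -/
def Star.edges {n k : ℕ} (s : Star n k) : Set (Edge n) :=
  {c | ∃ S : CoverStar k, projStar n S = s ∧ ∃ e ∈ S.edges, projEdge n e = c}

end HalfCylinder

/-! Lift $T$ to the cover: `Adj T` is an $n$-periodic relation on the integers without 3-crossings,
maximal among such relations (`PeriodicMaximal`). Everything rests on a local form of maximality: a
missing edge of length at most $2n$ is crossed by a 2-crossing (`doublyCrossed_of_not_adj`). This is
not immediate, because adding an edge also adds its translates, and a new 3-crossing may use two of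
them.

The edges of length $2n$ form a single translation class (`exists_adj_add_two_mul`,
`exists_eq_add_mul`), an infinite star bounding the configuration on the side of the unmarked
boundary. Among pairs longer than $2n$, only those joining two vertices of the infinite star at
distance at least $3n$ can fail to be doubly crossed (`doublyCrossed_or_long`).

As for $k$-triangulations of polygons, two consecutive edges at a vertex $u$ form an angle of a
unique 2-star. Crossing depends only on the cyclic order, so this is proved in a linear order with
least element $u$ (`exists_starAt`), then applied to the integers cut at $u$. The exceptional long
pairs never occur, unless the angle belongs to the infinite star.

Hence an edge has one star on each side. Below, it exists when the length exceeds 2, with the edge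
in one of 2 positions; above, when the length is at least 2 and not $2n$, with 3 positions. With $s$
stars this gives $2s$ edges longer than 2, and $3s$ edges of length at least 2 other than the single
class of length $2n$. All $n$ classes of length 2 are present, so $3s+1=2s+n$ and $s=n-1$. Adding
the $n$ classes of length 1 and the $n$ of length 2 gives the total. -/

namespace HalfCylinder

/-! ### Angles and 2-stars in a linear order. -/

section LinearOrder

variable {α : Type*} [LinearOrder α]

/-- No three pairwise crossing pairs are related by `A`. -/
def NoTripleCrossing (A : α → α → Prop) : Prop :=
  ∀ ⦃a₁ a₂ a₃ b₁ b₂ b₃ : α⦄, a₁ < a₂ → a₂ < a₃ → a₃ < b₁ → b₁ < b₂ → b₂ < b₃ →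
    A a₁ b₁ → A a₂ b₂ → A a₃ b₃ → False

/-- The pair `p < q` is crossed by two pairs related by `A` that cross each other. -/
def DoublyCrossed (A : α → α → Prop) (p q : α) : Prop :=
  ∃ g₁ h₁ g₂ h₂ : α, A g₁ g₂ ∧ A h₁ h₂ ∧ p < g₁ ∧ g₁ < h₁ ∧ h₁ < q ∧
    ((q < g₂ ∧ g₂ < h₂) ∨ (q < g₂ ∧ h₂ < p) ∨ (g₂ < h₂ ∧ h₂ < p))

/-- The edges of the `2`-star with vertices `u < x < w < v < y` are related by `A`. -/
structure StarAt (A : α → α → Prop) (u x w v y : α) : Prop where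
  hux : u < x
  hxw : x < w
  hwv : w < v
  hvy : v < y
  uw : A u w
  uv : A u v
  xv : A x v
  wy : A w y
  xy : A x y

variable {A : α → α → Prop}

/-- Such an edge would form a 3-crossing with $[x,v]$ and $[w,y]$. Thus $w$ and $v$ are consecutive
neighbours of $u$, and either of them determines the other. -/
theorem StarAt.not_adj (hA : NoTripleCrossing A) {u x w v y t : α} (h : StarAt A u x w v y)
    (hwt : w < t) (htv : t < v) : ¬ A u t := fun hut =>
  hA h.hux h.hxw hwt htv h.hvy hut h.xv h.wy

theorem StarAt.x_le (hA : NoTripleCrossing A) {u x w v y x' y' : α} (h : StarAt A u x w v y)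
    (h' : StarAt A u x' w v y') : x' ≤ x := by
  by_contra! hx
  exact hA h.hux hx h'.hxw h.hwv h'.hvy h.uw h.xv h'.xy

theorem StarAt.le_y (hA : NoTripleCrossing A) {u x w v y x' y' : α} (h : StarAt A u x w v y)
    (h' : StarAt A u x' w v y') : y ≤ y' := by
  by_contra! hy
  exact hA h'.hux h'.hxw h.hwv h'.hvy hy h.uv h'.xy h.wy

theorem StarAt.unique (hA : NoTripleCrossing A) {u x w v y x' y' : α} (h : StarAt A u x w v y)
    (h' : StarAt A u x' w v y') : x = x' ∧ y = y' :=
  ⟨(h'.x_le hA h).antisymm (h.x_le hA h'), (h.le_y hA h').antisymm (h'.le_y hA h)⟩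

theorem StarAt.unique_of_inner (hA : NoTripleCrossing A) {u x w v y x' v' y' : α}
    (h : StarAt A u x w v y) (h' : StarAt A u x' w v' y') : x = x' ∧ v = v' ∧ y = y' := by
  rcases lt_trichotomy v v' with hv | rfl | hv
  · exact (h'.not_adj hA h.hwv hv h.uv).elim
  · exact ⟨(h.unique hA h').1, rfl, (h.unique hA h').2⟩
  · exact (h.not_adj hA h'.hwv hv h'.uv).elim

theorem StarAt.unique_of_outer (hA : NoTripleCrossing A) {u x w v y x' w' y' : α}
    (h : StarAt A u x w v y) (h' : StarAt A u x' w' v y') : x = x' ∧ w = w' ∧ y = y' := by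
  rcases lt_trichotomy w w' with hw | rfl | hw
  · exact (h.not_adj hA hw h'.hwv h'.uw).elim
  · exact ⟨(h.unique hA h').1, rfl, (h.unique hA h').2⟩
  · exact (h'.not_adj hA hw h.hwv h.uw).elim

/-- An angle of a maximal set without triple crossings is an angle of a `2`-star. -/
theorem exists_starAt (hA : NoTripleCrossing A) (symm : ∀ ⦃p q⦄, A p q → A q p)
    {u w v : α} (hu : ∀ t, u ≤ t) (hwv : w < v) (huw : A u w) (huv : A u v)
    (gap : ∀ t, w < t → t < v → ¬ A u t)
    (across : ∃ x y, u < x ∧ x < w ∧ v < y ∧ A x y)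
    (finx : {x | ∃ y, u < x ∧ x < w ∧ v < y ∧ A x y}.Finite)
    (finy : {y | ∃ x, u < x ∧ x < w ∧ v < y ∧ A x y}.Finite)
    (mxv : ∀ x y, u < x → x < w → v < y → A x y → A x v ∨ DoublyCrossed A x v)
    (mwy : ∀ x y, u < x → x < w → v < y → A x y → A w y ∨ DoublyCrossed A w y)
    (mxy : ∀ x y x₀ y₀, u < x₀ → x₀ ≤ x → x < w → v < y → y ≤ y₀ → A x y₀ → A x₀ y →
      A x y ∨ DoublyCrossed A x y) :
    ∃ x y, StarAt A u x w v y := by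
  obtain ⟨x', y', hx', hxw', hvy', hxy'⟩ := across
  -- Among the edges from between $u$ and $w$ to beyond $v$, take the last left end $x$ and the
  -- first right end $y$, a priori on different edges $[x,y_0]$ and $[x_0,y]$. If $[x,v]$, $[w,y]$
  -- or $[x,y]$ were missing, a 2-crossing across it would make a 3-crossing with known edges or
  -- contradict this choice or the gap at $u$.
  obtain ⟨x, ⟨y₀, hx, hxw, hvy₀, hxy₀⟩, hxmax⟩ :=
    Set.exists_max_image _ id finx ⟨x', y', hx', hxw', hvy', hxy'⟩
  obtain ⟨y, ⟨x₀, hx₀, hxw₀, hvy, hx₀y⟩, hymin⟩ :=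
    Set.exists_min_image _ id finy ⟨y', x', hx', hxw', hvy', hxy'⟩
  have hxmax : ∀ a b, u < a → a < w → v < b → A a b → a ≤ x := fun a b h1 h2 h3 h4 =>
    hxmax a ⟨b, h1, h2, h3, h4⟩
  have hymin : ∀ a b, u < a → a < w → v < b → A a b → y ≤ b := fun a b h1 h2 h3 h4 =>
    hymin b ⟨a, h1, h2, h3, h4⟩
  have hx₀x : x₀ ≤ x := hxmax _ _ hx₀ hxw₀ hvy hx₀y
  have hyy₀ : y ≤ y₀ := hymin _ _ hx hxw hvy₀ hxy₀
  refine ⟨x, y, hx, hxw, hwv, hvy, huw, huv, ?_, ?_, ?_⟩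
  · refine (mxv x y₀ hx hxw hvy₀ hxy₀).resolve_right ?_
    rintro ⟨g₁, h₁, g₂, h₂, hg, hh, h1, h2, h3, ⟨h4, h5⟩ | ⟨h4, h5⟩ | ⟨h4, h5⟩⟩
    · exact hA (hx.trans h1) h2 h3 h4 h5 huv hg hh
    · have hwg : w ≤ g₁ := le_of_not_gt fun h =>
        (hxmax g₁ g₂ (hx.trans h1) h h4 hg).not_gt h1
      rcases (hu h₂).eq_or_lt with rfl | h6
      · exact gap h₁ (hwg.trans_lt h2) h3 (symm hh)
      · exact hA h6 h5 hxw (hwg.trans_lt h2) (h3.trans hvy₀) huw (symm hh) hxy₀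
    · exact hA h4 h5 h1 h2 (h3.trans hvy₀) (symm hg) (symm hh) hxy₀
  · refine (mwy x₀ y hx₀ hxw₀ hvy hx₀y).resolve_right ?_
    rintro ⟨g₁, h₁, g₂, h₂, hg, hh, h1, h2, h3, ⟨h4, h5⟩ | ⟨h4, h5⟩ | ⟨h4, h5⟩⟩
    · exact hA (hxw₀.trans h1) h2 h3 h4 h5 hx₀y hg hh
    · rcases lt_or_ge h₂ x₀ with h6 | h6
      · exact hA h6 (hxw₀.trans h1) h2 h3 h4 (symm hh) hx₀y hg
      · have hv : h₁ ≤ v := le_of_not_gt fun h =>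
          (hymin h₂ h₁ (hx₀.trans_le h6) h5 h (symm hh)).not_gt h3
        exact hA hx₀ (hxw₀.trans h1) (h2.trans_le hv) hvy h4 huv hx₀y hg
    · rcases (hu g₂).eq_or_lt with rfl | h6
      · have hv : v ≤ g₁ := le_of_not_gt fun h => gap g₁ h1 h (symm hg)
        exact (hymin h₂ h₁ h4 h5 (hv.trans_lt h2) (symm hh)).not_gt h3
      · exact hA h6 h4 h5 h1 h2 huw (symm hg) (symm hh)
  · refine (mxy x y x₀ y₀ hx₀ hx₀x hxw hvy hyy₀ hxy₀ hx₀y).resolve_right ?_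
    rintro ⟨g₁, h₁, g₂, h₂, hg, hh, h1, h2, h3, ⟨h4, h5⟩ | ⟨h4, h5⟩ | ⟨h4, h5⟩⟩
    · exact hA (hx₀x.trans_lt h1) h2 h3 h4 h5 hx₀y hg hh
    · rcases lt_or_ge h₂ x₀ with h6 | h6
      · exact hA h6 (hx₀x.trans_lt h1) h2 h3 h4 (symm hh) hx₀y hg
      have hwg : w ≤ g₁ := le_of_not_gt fun h =>
        (hxmax g₁ g₂ (hx.trans h1) h (hvy.trans h4) hg).not_gt h1
      exact hA (hx₀.trans_le h6) h5 hxw (hwg.trans_lt h2) (h3.trans_le hyy₀) huw (symm hh) hxy₀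
    · exact hA h4 h5 h1 h2 (h3.trans_le hyy₀) (symm hg) (symm hh) hxy₀

end LinearOrder

/-! ### Periodic maximal sets: double crossings and the infinite star. -/

/-- `A` is the adjacency relation of an `n`-periodic set of edges without triple crossings that is
maximal among such sets. -/
structure PeriodicMaximal (n : ℤ) (A : ℤ → ℤ → Prop) : Prop where
  pos : 0 < n
  symm : ∀ ⦃p q⦄, A p q → A q p
  add_mul : ∀ ⦃p q⦄ (l : ℤ), A p q → A (p + l * n) (q + l * n)
  noTriple : NoTripleCrossing A
  maximal : ∀ ⦃p q⦄, p < q → ¬ A p q → ¬ NoTripleCrossing fun a b =>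
    A a b ∨ ∃ l : ℤ, a = p + l * n ∧ b = q + l * n

namespace PeriodicMaximal

variable {n : ℤ} {A : ℤ → ℤ → Prop}

theorem add (h : PeriodicMaximal n A) {p q : ℤ} (hpq : A p q) : A (p + n) (q + n) := by
  simpa using h.add_mul 1 hpq

theorem sub (h : PeriodicMaximal n A) {p q : ℤ} (hpq : A p q) : A (p - n) (q - n) := by
  simpa [sub_eq_add_neg] using h.add_mul (-1) hpq

/-- A longer edge and its translates by $n$ and $2n$ would be a 3-crossing. -/
theorem le_add (h : PeriodicMaximal n A) {p q : ℤ} (hpq : A p q) : q ≤ p + 2 * n := by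
  by_contra! hlt
  have := h.pos
  exact h.noTriple (a₁ := p) (a₂ := p + n) (a₃ := p + n + n) (b₁ := q) (b₂ := q + n)
    (b₃ := q + n + n) (by lia) (by lia) (by lia) (by lia) (by lia) hpq (h.add hpq)
    (h.add (h.add hpq))

theorem doublyCrossed_add_mul (h : PeriodicMaximal n A)
    {p q : ℤ} (l : ℤ) (hX : DoublyCrossed A (p + l * n) (q + l * n)) :
    DoublyCrossed A p q := by
  obtain ⟨g₁, h₁, g₂, h₂, hg, hh, h1, h2, h3, h4⟩ := hX
  refine ⟨_, _, _, _, h.add_mul (-l) hg, h.add_mul (-l) hh, ?_, ?_, ?_, ?_⟩ <;>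
    simp only [neg_mul] <;> lia

/-- A missing edge of length at most `2 n` is crossed by a `2`-crossing, or else forms a
`3`-crossing with its translate by `n` and a further edge. -/
theorem doublyCrossed_or_translate (h : PeriodicMaximal n A)
    {p q : ℤ} (hpq : p < q) (hlen : q ≤ p + 2 * n)
    (hA : ¬ A p q) : DoublyCrossed A p q ∨ ∃ c d, A c d ∧ p + n < q ∧
      ((c < p ∧ p + n < d ∧ d < q) ∨ (p < c ∧ c < p + n ∧ q < d ∧ d < q + n) ∨
        (p + n < c ∧ c < q ∧ q + n < d)) := by
  have hn := h.pos
  -- As $q-p\le 2n$, two translates of $[p,q]$ can cross only if they are adjacent.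
  have key : ∀ l m : ℤ, p + l * n < p + m * n → p + m * n < q + l * n →
      m * n = l * n + n ∧ p + n < q := by
    intro l m h1 h2
    have h3 : l < m := by by_contra! hc; nlinarith
    have h4 : m < l + 2 := by by_contra! hc; nlinarith
    obtain rfl : m = l + 1 := by lia
    constructor
    · ring
    · nlinarith
  have hmax := h.maximal hpq hA
  simp only [NoTripleCrossing, not_forall] at hmax
  obtain ⟨a₁, a₂, a₃, b₁, b₂, b₃, h1, h2, h3, h4, h5, e1, e2, e3, -⟩ := hmax
  rcases e1 with e1 | ⟨l₁, rfl, rfl⟩ <;> rcases e2 with e2 | ⟨l₂, rfl, rfl⟩ <;>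
    rcases e3 with e3 | ⟨l₃, rfl, rfl⟩
  · exact (h.noTriple h1 h2 h3 h4 h5 e1 e2 e3).elim
  · exact .inl <| h.doublyCrossed_add_mul l₃
      ⟨b₁, b₂, a₁, a₂, h.symm e1, h.symm e2, h3, h4, h5, .inr (.inr ⟨h1, h2⟩)⟩
  · exact .inl <| h.doublyCrossed_add_mul l₂
      ⟨a₃, b₁, b₃, a₁, e3, h.symm e1, h2, h3, h4, .inr (.inl ⟨h5, h1⟩)⟩
  · have k := key l₂ l₃ h2 (by lia)
    refine .inr ⟨a₁ + -l₂ * n, b₁ + -l₂ * n, h.add_mul _ e1, k.2, .inl ?_⟩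
    simp only [neg_mul]; lia
  · exact .inl <| h.doublyCrossed_add_mul l₁
      ⟨a₂, a₃, b₂, b₃, e2, e3, h1, h2, h3, .inl ⟨h4, h5⟩⟩
  · have k := key l₁ l₃ (by lia) (by lia)
    refine .inr ⟨a₂ + -l₁ * n, b₂ + -l₁ * n, h.add_mul _ e2, k.2, .inr (.inl ?_)⟩
    simp only [neg_mul]; lia
  · have k := key l₁ l₂ (by lia) (by lia)
    refine .inr ⟨a₃ + -l₁ * n, b₃ + -l₁ * n, h.add_mul _ e3, k.2, .inr (.inr ?_)⟩
    simp only [neg_mul]; lia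
  -- Three translates cannot cross pairwise: the outer two would not be adjacent.
  · have k := key l₁ l₂ (by lia) (by lia)
    have k' := key l₂ l₃ (by lia) (by lia)
    lia

/-- The critical case: the translate and an edge of length at most `n` crossing both. -/
theorem doublyCrossed_of_short_mid (h : PeriodicMaximal n A)
    {a b c d : ℤ} (hcd : A c d) (hac : a < c)
    (hca : c < a + n) (hab : a + n < b) (hbd : b < d) (hdc : d ≤ c + n) :
    DoublyCrossed A a b := by
  have hn := h.pos
  -- The chord $[a,a+n]$ does not cross its own translates, so it is either an edge or doubly
  -- crossed. If it is an edge, its translate $[a+n,a+2n]$ and $[c,d]$ doubly cross $[a,b]$.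
  -- Otherwise a 2-crossing across it, suitably translated or combined with $[c,d]$, does.
  by_cases he : A a (a + n)
  · exact ⟨c, a + n, d, a + n + n, hcd, h.add he, by lia, by lia, by lia, .inl (by lia)⟩
  rcases h.doublyCrossed_or_translate (by lia) (by lia) he with hX | ⟨c', d', -, hlt, -⟩
  swap
  · lia
  obtain ⟨g₁, h₁, g₂, h₂, hg, hh, h1, h2, h3, h4⟩ := hX
  by_cases hgb : g₂ < a ∨ b < g₂
  · by_cases hhb : h₂ < a ∨ b < h₂
    · exact ⟨g₁, h₁, g₂, h₂, hg, hh, by lia, by lia, by lia, by lia⟩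
    · lia
  by_cases hgc : g₁ < c
  · exact ⟨g₂ - n, d - n, g₁ - n, c - n, h.symm (h.sub hg), h.symm (h.sub hcd), by lia, by lia,
      by lia, by lia⟩
  by_cases hhb : a + n < h₂ ∧ h₂ < b + n
  · exact ⟨g₂ - n, h₂ - n, g₁ - n, h₁ - n, h.symm (h.sub hg), h.symm (h.sub hh), by lia, by lia,
      by lia, by lia⟩
  · exact ⟨c, h₁, d, h₂, hcd, hh, by lia, by lia, by lia, by lia⟩

theorem doublyCrossed_of_not_adj (h : PeriodicMaximal n A)
    {p q : ℤ} (hpq : p < q) (hlen : q ≤ p + 2 * n)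
    (hA : ¬ A p q) : DoublyCrossed A p q := by
  have hn := h.pos
  rcases h.doublyCrossed_or_translate hpq hlen hA with hX | ⟨c, d, hcd, hlt, hc | hc | hc⟩
  · exact hX
  -- Except in the critical case, $[c,d]$ and one of its translates by $\pm n$ form the required
  -- 2-crossing.
  · have := h.le_add hcd
    exact ⟨c + n, d, d + n, c, h.add hcd, h.symm hcd, by lia, by lia, by lia, by lia⟩
  · by_cases hdc : d ≤ c + n
    · exact h.doublyCrossed_of_short_mid hcd hc.1 hc.2.1 hlt hc.2.2.1 hdc
    · exact ⟨c, d - n, d, c - n, hcd, h.symm (h.sub hcd), by lia, by lia, by lia, by lia⟩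
  · exact ⟨c - n, c, d - n, d, h.sub hcd, hcd, by lia, by lia, by lia, by lia⟩

/-- A doubly crossed pair has at least two points strictly between its ends. -/
theorem adj_of_le_two (h : PeriodicMaximal n A)
    {p q : ℤ} (hpq : p < q) (hq : q ≤ p + 2) : A p q := by
  have hn := h.pos
  by_contra hA
  obtain ⟨g₁, h₁, g₂, h₂, hg, hh, h1, h2, h3, h4⟩ :=
    h.doublyCrossed_of_not_adj hpq (by lia) hA
  lia

/-- Otherwise, choose a 2-crossing over 0 whose first right end $p_2$ is maximal, and a 2-crossing
over $p_2$. The absence of 3-crossings nests the ends so that one edge of each forms a 2-crossing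
over 0 with a larger first right end. -/
theorem exists_not_covered (h : PeriodicMaximal n A)
    : ∃ a, ∀ p₁ q₁ p₂ q₂, p₁ < q₁ → q₁ < a → a < p₂ → p₂ < q₂ →
    A p₁ p₂ → ¬ A q₁ q₂ := by
  by_contra! hcov
  obtain ⟨p₂, ⟨p₁, q₁, q₂, h1, h2, h3, h4, hp, hq⟩, hmax⟩ :=
    Int.exists_greatest_of_bdd (P := fun p₂ => ∃ p₁ q₁ q₂, p₁ < q₁ ∧ q₁ < 0 ∧ 0 < p₂ ∧ p₂ < q₂ ∧
      A p₁ p₂ ∧ A q₁ q₂) ⟨2 * n, by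
        rintro z ⟨p₁, q₁, q₂, h1, h2, h3, h4, hp, hq⟩
        have := h.le_add hp
        lia⟩ (by obtain ⟨p₁, q₁, p₂, q₂, hc⟩ := hcov 0; exact ⟨p₂, p₁, q₁, q₂, hc⟩)
  obtain ⟨p₁', q₁', p₂', q₂', h1', h2', h3', h4', hp', hq'⟩ := hcov p₂
  have hq0 : 0 ≤ q₁' := by
    by_contra! hc
    have := hmax p₂' ⟨p₁', q₁', q₂', h1', hc, by lia, h4', hp', hq'⟩
    lia
  have hqq : q₂' ≤ q₂ := by
    by_contra! hc
    exact h.noTriple h1 (by lia) h2' h4 hc hp hq hq'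
  have hpp : p₁' ≤ p₁ := by
    by_contra! hc
    exact h.noTriple hc h1' h2' h3' h4' hp hp' hq'
  have := hmax p₂' ⟨p₁', q₁, q₂, by lia, h2, by lia, by lia, hp', hq⟩
  lia

/-- A 2-crossing across $[a,a+2n]$ gives, after moving edges back by $2n$ where needed, a 2-crossing
over $a$; so an uncovered $a$ works. -/
theorem exists_adj_add_two_mul (h : PeriodicMaximal n A) : ∃ a, A a (a + 2 * n) := by
  have hn := h.pos
  obtain ⟨a, ha⟩ := h.exists_not_covered
  refine ⟨a, by_contra fun hA => ?_⟩
  obtain ⟨g₁, h₁, g₂, h₂, hg, hh, h1, h2, h3, h4 | h4 | h4⟩ :=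
    h.doublyCrossed_of_not_adj (by lia) le_rfl hA
  · exact ha _ _ _ _ (by lia) (by lia) (by lia) (by lia) (h.sub (h.sub hg)) (h.sub (h.sub hh))
  · have := h.le_add hg
    have := h.le_add (h.symm hh)
    exact ha (g₁ - n - n) h₂ (g₂ - n - n) h₁ (by lia) (by lia) (by lia) (by lia)
      (h.sub (h.sub hg)) (h.symm hh)
  · exact ha _ _ _ _ h4.1 h4.2 h1 h2 (h.symm hg) (h.symm hh)

/-- Edges starting strictly between two consecutive vertices of the infinite star are confined. -/
theorem confined (h : PeriodicMaximal n A)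
    {z p q : ℤ} (hz : A z (z + 2 * n)) (hpq : A p q) (hzp : z < p)
    (hpz : p < z + n) : z - n ≤ q ∧ q ≤ z + 2 * n := by
  have hn := h.pos
  have hz' := h.sub hz
  constructor <;> by_contra! hc
  · exact h.noTriple hc (by lia) hzp (by lia) (by lia) (h.symm hpq) hz' hz
  · exact h.noTriple (by lia) hzp (by lia) (by lia) hc hz' hz hpq

theorem exists_floor (h : PeriodicMaximal n A) {a : ℤ} (ha : A a (a + 2 * n)) (p : ℤ) :
    ∃ l : ℤ, A (a + l * n) (a + l * n + 2 * n) ∧ a + l * n ≤ p ∧ p < a + l * n + n := by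
  have hn := h.pos
  refine ⟨(p - a) / n, ?_, ?_, ?_⟩
  · convert h.add_mul ((p - a) / n) ha using 1; ring
  · have := Int.ediv_mul_le (p - a) hn.ne'
    lia
  · have := Int.lt_ediv_add_one_mul_self (p - a) hn
    rw [_root_.add_mul] at this
    lia

theorem exists_eq_add_mul (h : PeriodicMaximal n A)
    {a b : ℤ} (ha : A a (a + 2 * n)) (hb : A b (b + 2 * n)) :
    ∃ l : ℤ, b = a + l * n := by
  obtain ⟨l, hl, h1, h2⟩ := h.exists_floor ha b
  refine ⟨l, ?_⟩
  by_contra hne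
  have := h.confined hl hb (by lia) h2
  lia

/-- If an end of a pair longer than $2n$ lies strictly between consecutive vertices of the infinite
star, the two edges of that star passing over this end doubly cross the pair. If both ends are
vertices, the length is a multiple of $n$ exceeding $2n$. -/
theorem doublyCrossed_or_long (h : PeriodicMaximal n A)
    {p q : ℤ} (hpq : p < q) : A p q ∨ DoublyCrossed A p q ∨
    (A p (p + 2 * n) ∧ A q (q + 2 * n) ∧ p + 3 * n ≤ q) := by
  have hn := h.pos
  rcases le_or_gt q (p + 2 * n) with hq | hq
  · exact (em _).imp_right fun hA => .inl (h.doublyCrossed_of_not_adj hpq hq hA)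
  obtain ⟨a, ha⟩ := h.exists_adj_add_two_mul
  obtain ⟨l, hl, h1, h2⟩ := h.exists_floor ha p
  obtain ⟨m, hm, h3, h4⟩ := h.exists_floor ha q
  right
  rcases h1.eq_or_lt with h1 | h1
  · rcases h3.eq_or_lt with h3 | h3
    · right
      rw [← h1, ← h3]
      refine ⟨hl, hm, ?_⟩
      have : l + 2 < m := by by_contra! hc; nlinarith
      nlinarith
    · left
      exact ⟨_, _, _, _, h.sub hm, hm, by lia, by lia, by lia, .inl (by lia)⟩
  · left
    exact ⟨_, _, _, _, h.symm (h.sub hl), h.symm hl, by lia, by lia, by lia, .inr (.inr (by lia))⟩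

end PeriodicMaximal

/-! ### Cutting the cyclic order at a vertex. -/

/-- The integers in the cyclic order cut just before `u`: first `u, u + 1, …`, then `…, u - 1`. -/
@[ext]
structure CutAt (u : ℤ) where
  val : ℤ

namespace CutAt

instance (u : ℤ) : LinearOrder (CutAt u) :=
  LinearOrder.lift' (fun t => toLex ((if t.val < u then 1 else 0 : ℤ), t.val)) fun _ _ hst =>
    CutAt.ext (congrArg (fun r => (ofLex r).2) hst)

theorem lt_iff {u : ℤ} {s t : CutAt u} :
    s < t ↔ (u ≤ s.val ∧ t.val < u) ∨ (s.val < t.val ∧ (u ≤ s.val ∨ t.val < u)) := by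
  change toLex ((if s.val < u then 1 else 0 : ℤ), s.val) <
    toLex ((if t.val < u then 1 else 0 : ℤ), t.val) ↔ _
  rw [Prod.Lex.toLex_lt_toLex]
  split_ifs <;> omega

theorem le_iff {u : ℤ} {s t : CutAt u} :
    s ≤ t ↔ (u ≤ s.val ∧ t.val < u) ∨ (s.val ≤ t.val ∧ (u ≤ s.val ∨ t.val < u)) := by
  rw [← not_lt, lt_iff]
  omega

/-- A relation on the integers as a relation on the cut order. -/
def lift (A : ℤ → ℤ → Prop) (u : ℤ) (s t : CutAt u) : Prop := A s.val t.val

variable {A : ℤ → ℤ → Prop}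

/-- Pairwise crossing depends only on the cyclic order of the six ends; the cases locate where the
cut falls among them. -/
theorem noTripleCrossing (symm : ∀ ⦃p q⦄, A p q → A q p) (hA : NoTripleCrossing A) (u : ℤ) :
    NoTripleCrossing (lift A u) := by
  rintro ⟨a₁⟩ ⟨a₂⟩ ⟨a₃⟩ ⟨b₁⟩ ⟨b₂⟩ ⟨b₃⟩ h1 h2 h3 h4 h5 e1 e2 e3
  simp only [lt_iff, lift] at *
  by_cases k1 : a₁ < a₂
  · by_cases k2 : a₂ < a₃
    · by_cases k3 : a₃ < b₁
      · by_cases k4 : b₁ < b₂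
        · by_cases k5 : b₂ < b₃
          · exact hA k1 k2 k3 k4 k5 e1 e2 e3
          · exact hA (a₁ := b₃) (by omega) k1 k2 k3 k4 (symm e3) e1 e2
        · exact hA (a₁ := b₂) (a₂ := b₃) (by omega) (by omega) k1 k2 k3 (symm e2) (symm e3) e1
      · exact hA (a₁ := b₁) (a₂ := b₂) (a₃ := b₃) (by omega) (by omega) (by omega) k1 k2
          (symm e1) (symm e2) (symm e3)
    · exact hA (a₁ := a₃) (a₂ := b₁) (a₃ := b₂) (by omega) (by omega) (by omega) (by omega)
        (by omega) e3 (symm e1) (symm e2)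
  · exact hA (a₁ := a₂) (a₂ := a₃) (a₃ := b₁) (by omega) (by omega) (by omega) (by omega)
      (by omega) e2 e3 (symm e1)

theorem doublyCrossed_of_lt {u : ℤ} {p q : CutAt u} (hpq : p < q) (hlt : p.val < q.val)
    (hX : DoublyCrossed A p.val q.val) : DoublyCrossed (lift A u) p q := by
  obtain ⟨g₁, h₁, g₂, h₂, hg, hh, h1, h2, h3, h4⟩ := hX
  refine ⟨⟨g₁⟩, ⟨h₁⟩, ⟨g₂⟩, ⟨h₂⟩, hg, hh, ?_⟩
  simp only [lt_iff] at hpq ⊢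
  omega

/-- Reversing the pair exchanges its inside and its outside, hence the ends of the crossing edges.
-/
theorem doublyCrossed_of_gt (symm : ∀ ⦃p q⦄, A p q → A q p) {u : ℤ} {p q : CutAt u}
    (hpq : p < q) (hlt : q.val < p.val) (hX : DoublyCrossed A q.val p.val) :
    DoublyCrossed (lift A u) p q := by
  obtain ⟨g₁, h₁, g₂, h₂, hg, hh, h1, h2, h3, h4⟩ := hX
  refine ⟨⟨g₂⟩, ⟨h₂⟩, ⟨g₁⟩, ⟨h₁⟩, symm hg, symm hh, ?_⟩
  simp only [lt_iff] at hpq ⊢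
  omega

end CutAt

open CutAt (lift)

/-! ### A 2-star seen from its first, second and third vertex. -/

section Rotation

variable {A : ℤ → ℤ → Prop} {z₀ z₁ z₂ z₃ z₄ : ℤ}

theorem StarAt.cutAt_zero (hS : StarAt A z₀ z₁ z₂ z₃ z₄) :
    StarAt (lift A z₀) ⟨z₀⟩ ⟨z₁⟩ ⟨z₂⟩ ⟨z₃⟩ ⟨z₄⟩ := by
  obtain ⟨h1, h2, h3, h4, e1, e2, e3, e4, e5⟩ := hS
  refine ⟨?_, ?_, ?_, ?_, e1, e2, e3, e4, e5⟩ <;> rw [CutAt.lt_iff] <;> grind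

theorem StarAt.cutAt_one (symm : ∀ ⦃p q⦄, A p q → A q p) (hS : StarAt A z₀ z₁ z₂ z₃ z₄) :
    StarAt (lift A z₁) ⟨z₁⟩ ⟨z₂⟩ ⟨z₃⟩ ⟨z₄⟩ ⟨z₀⟩ := by
  obtain ⟨h1, h2, h3, h4, e1, e2, e3, e4, e5⟩ := hS
  refine ⟨?_, ?_, ?_, ?_, e3, e5, e4, symm e2, symm e1⟩ <;> rw [CutAt.lt_iff] <;> grind

theorem StarAt.cutAt_two (symm : ∀ ⦃p q⦄, A p q → A q p) (hS : StarAt A z₀ z₁ z₂ z₃ z₄) :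
    StarAt (lift A z₂) ⟨z₂⟩ ⟨z₃⟩ ⟨z₄⟩ ⟨z₀⟩ ⟨z₁⟩ := by
  obtain ⟨h1, h2, h3, h4, e1, e2, e3, e4, e5⟩ := hS
  refine ⟨?_, ?_, ?_, ?_, e4, symm e1, symm e2, symm e5, symm e3⟩ <;> rw [CutAt.lt_iff] <;> grind

end Rotation

/-! ### Existence of the stars on both sides of an edge. -/

namespace PeriodicMaximal

variable {n : ℤ} {A : ℤ → ℤ → Prop}

theorem cutAt_maximal (h : PeriodicMaximal n A) {u : ℤ} {p q : CutAt u} (hpq : p < q)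
    (h1 : A q.val (q.val + 2 * n) → ¬ p.val + 3 * n ≤ q.val)
    (h2 : A p.val (p.val + 2 * n) → ¬ q.val + 3 * n ≤ p.val) :
    lift A u p q ∨ DoublyCrossed (lift A u) p q := by
  rcases lt_trichotomy p.val q.val with hlt | heq | hlt
  · rcases h.doublyCrossed_or_long hlt with hA | hX | ⟨-, hz, hl⟩
    · exact .inl hA
    · exact .inr (CutAt.doublyCrossed_of_lt hpq hlt hX)
    · exact (h1 hz hl).elim
  · exact (hpq.ne (CutAt.ext heq)).elim
  · rcases h.doublyCrossed_or_long hlt with hA | hX | ⟨-, hz, hl⟩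
    · exact .inl (h.symm hA)
    · exact .inr (CutAt.doublyCrossed_of_gt h.symm hpq hlt hX)
    · exact (h2 hz hl).elim

/-- The angle at `u` between `w` and `v` belongs to a `2`-star, as soon as the other edges of this
star cannot be chords of length at least `3 n` of the infinite star. -/
theorem exists_starAt_cutAt (h : PeriodicMaximal n A)
    {u w v : ℤ} (huw : A u w) (huv : A u v) (hw : u + 2 ≤ w)
    (hwv : w < v ∨ v + 2 ≤ u)
    (gap : ∀ t : CutAt u, ⟨w⟩ < t → t < ⟨v⟩ → ¬ A u t.val)
    (hlong : ∀ x x₀ y₀ : ℤ, ∀ y : CutAt u, u < x₀ → x₀ ≤ x → x < w → ⟨v⟩ < y →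
      y ≤ ⟨y₀⟩ → A x y₀ → A x₀ y.val →
      (A x (x + 2 * n) → ¬ v + 3 * n ≤ x) ∧ (A w (w + 2 * n) → ¬ y.val + 3 * n ≤ w) ∧
        (A x (x + 2 * n) → ¬ y.val + 3 * n ≤ x)) :
    ∃ x y : ℤ, StarAt (lift A u) ⟨u⟩ ⟨x⟩ ⟨w⟩ ⟨v⟩ ⟨y⟩ := by
  have hn := h.pos
  have hvu := h.le_add huv
  have lin : ∀ {x : CutAt u}, ⟨u⟩ < x → x < ⟨w⟩ → u < x.val ∧ x.val < w := by
    intro x h1 h2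
    rw [CutAt.lt_iff] at h1 h2
    grind
  suffices ∃ x y, StarAt (lift A u) ⟨u⟩ x ⟨w⟩ ⟨v⟩ y by
    obtain ⟨⟨x⟩, ⟨y⟩, hS⟩ := this
    exact ⟨x, y, hS⟩
  -- The edge $[u-1,u+1]$ has length 2, hence is present, and it crosses both sides of the angle.
  refine exists_starAt (CutAt.noTripleCrossing h.symm h.noTriple u) (fun _ _ hA => h.symm hA)
    (fun t => ?_) ?_ huw huv gap ⟨⟨u + 1⟩, ⟨u - 1⟩, ?_, ?_, ?_, ?_⟩ ?_ ?_ ?_ ?_ ?_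
  · rw [CutAt.le_iff]; grind
  · rw [CutAt.lt_iff]; grind
  · rw [CutAt.lt_iff]; grind
  · rw [CutAt.lt_iff]; grind
  · rw [CutAt.lt_iff]; grind
  · exact h.symm (h.adj_of_le_two (by grind) (by grind))
  · refine Set.Finite.subset ((Set.finite_Ioo u w).image CutAt.mk) ?_
    rintro ⟨x⟩ ⟨y, h1, h2, -⟩
    exact ⟨x, lin h1 h2, rfl⟩
  · refine Set.Finite.subset ((Set.finite_Icc (u - 2 * n) (w + 2 * n)).image CutAt.mk) ?_
    rintro ⟨y⟩ ⟨⟨x⟩, h1, h2, -, h3⟩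
    have h4 := h.le_add h3
    have h5 := h.le_add (h.symm h3)
    have h6 := lin h1 h2
    exact ⟨y, ⟨by grind, by grind⟩, rfl⟩
  · rintro ⟨x⟩ ⟨y⟩ h1 h2 h3 h4
    have h6 := lin h1 h2
    refine h.cutAt_maximal ?_ ?_ ?_
    · rw [CutAt.lt_iff]; grind
    · intro _; grind
    · exact (hlong x x y ⟨y⟩ h6.1 le_rfl h6.2 h3 le_rfl h4 h4).1
  · rintro ⟨x⟩ ⟨y⟩ h1 h2 h3 h4
    have h6 := lin h1 h2
    have h7 := h.le_add h4
    refine h.cutAt_maximal ?_ ?_ ?_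
    · rw [CutAt.lt_iff] at h3 ⊢; grind
    · intro _; grind
    · exact (hlong x x y ⟨y⟩ h6.1 le_rfl h6.2 h3 le_rfl h4 h4).2.1
  · rintro ⟨x⟩ ⟨y⟩ ⟨x₀⟩ ⟨y₀⟩ h1 h2 h3 h4 h5 h6 h7
    have h8 := lin (h1.trans_le h2) h3
    have h9 := lin h1 (h2.trans_lt h3)
    have h10 := h.le_add h7
    rw [CutAt.le_iff] at h2
    refine h.cutAt_maximal ?_ ?_ ?_
    · rw [CutAt.lt_iff] at h4 ⊢; grind
    · intro _; grind
    · exact (hlong x x₀ y₀ ⟨y⟩ h9.1 (by grind) h8.2 h4 h5 h6 h7).2.2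

/-- The angle between two edges `[u, w]` and `[u, v]` with `u < w < v` belongs to a `2`-star. -/
theorem exists_starAt_of_lt (h : PeriodicMaximal n A)
    {u w v : ℤ} (huw : A u w) (huv : A u v) (hw : u + 2 ≤ w)
    (hwv : w < v) (gap : ∀ t, w < t → t < v → ¬ A u t) :
    ∃ x y : ℤ, StarAt (lift A u) ⟨u⟩ ⟨x⟩ ⟨w⟩ ⟨v⟩ ⟨y⟩ := by
  have hn := h.pos
  have hvu := h.le_add huv
  refine h.exists_starAt_cutAt huw huv hw (.inl hwv) ?_ ?_
  · intro t h1 h2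
    rw [CutAt.lt_iff] at h1 h2
    exact gap _ (by grind) (by grind)
  · rintro x x₀ y₀ ⟨y⟩ h1 h2 h3 h4 h5 h6 h7
    rw [CutAt.lt_iff] at h4
    rw [CutAt.le_iff] at h5
    have k1 := h.le_add (h.symm h6)
    have k2 := h.le_add (h.symm h7)
    -- If $t$ is a vertex of the infinite star and $u$ lies strictly between $t-2n$ and $t-n$,
    -- confinement keeps the neighbour $v$ of $u$ from passing $t$.
    have conf : ∀ t, A t (t + 2 * n) → t - 2 * n < u → u < t - n → v ≤ t := by
      intro t ht h1 h2
      have := h.confined (z := t - 2 * n) (by convert h.sub (h.sub ht) using 1 <;> ring) huv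
        h1 (by omega)
      omega
    dsimp only at *
    refine ⟨fun _ => by omega, fun hz => ?_, fun hz => ?_⟩
    · have := conf w hz
      have := h.le_add huw
      omega
    · have := conf x hz
      omega

/-- The angle at `u` that faces the inner boundary belongs to a `2`-star, unless it is an angle of
the infinite star. -/
theorem exists_starAt_of_gt (h : PeriodicMaximal n A)
    {u w v : ℤ} (huw : A u w) (huv : A u v) (hw : u + 2 ≤ w)
    (hv : v + 2 ≤ u) (hne : w ≠ u + 2 * n) (gap : ∀ t, A u t → v ≤ t ∧ t ≤ w) :
    ∃ x y : ℤ, StarAt (lift A u) ⟨u⟩ ⟨x⟩ ⟨w⟩ ⟨v⟩ ⟨y⟩ := by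
  have hn := h.pos
  obtain ⟨a, ha⟩ := h.exists_adj_add_two_mul
  obtain ⟨l, hl, h1, h2⟩ := h.exists_floor ha u
  -- A vertex $u$ of the infinite star would have its last neighbour at $u+2n$, which `hne`
  -- excludes.
  have h1 : a + l * n < u := by
    refine h1.lt_of_ne fun heq => hne ?_
    rw [heq] at hl
    exact (h.le_add huw).antisymm (gap _ hl).2
  have k1 := h.confined hl huw h1 h2
  have k2 := h.confined hl huv h1 h2
  refine h.exists_starAt_cutAt huw huv hw (.inr hv) ?_ ?_
  · intro t h1 h2 ht
    have := gap _ ht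
    rw [CutAt.lt_iff] at h1 h2
    grind
  · rintro x x₀ y₀ ⟨y⟩ h1 h2 h3 h4 h5 h6 h7
    rw [CutAt.lt_iff] at h4
    dsimp only at *
    refine ⟨fun _ => ?_, fun hz => ?_, fun hz => ?_⟩ <;> omega

theorem exists_star_below (h : PeriodicMaximal n A) {p q : ℤ} (hpq : A p q) (hlen : p + 2 < q) :
    ∃ z₀ z₁ z₂ z₃ z₄, StarAt A z₀ z₁ z₂ z₃ z₄ ∧ ((p = z₀ ∧ q = z₃) ∨ (p = z₁ ∧ q = z₄)) := by
  -- The angle at $p$ between $q$ and the preceding neighbour; $p+2$ guarantees that there is one.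
  obtain ⟨w, ⟨hw, hwq, hpw⟩, hmax⟩ := Int.exists_greatest_of_bdd
    (P := fun w => p + 2 ≤ w ∧ w < q ∧ A p w) ⟨q, fun _ hz => hz.2.1.le⟩
    ⟨p + 2, le_rfl, hlen, h.adj_of_le_two (by omega) le_rfl⟩
  obtain ⟨x, y, h1, h2, h3, h4, e1, e2, e3, e4, e5⟩ := h.exists_starAt_of_lt hpw hpq hw hwq
    fun t h1 h2 h3 => (hmax t ⟨by omega, h2, h3⟩).not_gt h1
  simp only [CutAt.lt_iff] at h1 h2 h3 h4
  rcases lt_or_ge y p with hy | hy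
  · exact ⟨y, p, x, w, q, ⟨by omega, by omega, by omega, by omega, h.symm e5, h.symm e4, e1, e3,
      e2⟩, .inr ⟨rfl, rfl⟩⟩
  · exact ⟨p, x, w, q, y, ⟨by omega, by omega, by omega, by omega, e1, e2, e3, e4, e5⟩,
      .inl ⟨rfl, rfl⟩⟩

theorem exists_star_above (h : PeriodicMaximal n A)
    {p q : ℤ} (hpq : A p q) (hlen : p + 2 ≤ q) (hne : q ≠ p + 2 * n) :
    ∃ z₀ z₁ z₂ z₃ z₄, StarAt A z₀ z₁ z₂ z₃ z₄ ∧
      ((p = z₀ ∧ q = z₂) ∨ (p = z₁ ∧ q = z₃) ∨ (p = z₂ ∧ q = z₄)) := by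
  by_cases hex : ∃ t, q < t ∧ A p t
  · obtain ⟨v, ⟨hqv, hpv⟩, hmin⟩ := Int.exists_least_of_bdd
      (P := fun v => q < v ∧ A p v) ⟨q, fun _ hz => hz.1.le⟩ hex
    obtain ⟨x, y, h1, h2, h3, h4, e1, e2, e3, e4, e5⟩ := h.exists_starAt_of_lt hpq hpv hlen hqv
      fun t h1 h2 h3 => (hmin t ⟨h1, h3⟩).not_gt h2
    simp only [CutAt.lt_iff] at h1 h2 h3 h4
    rcases lt_or_ge y p with hy | hy
    · exact ⟨y, p, x, q, v, ⟨by omega, by omega, by omega, by omega, h.symm e5, h.symm e4, e1, e3,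
        e2⟩, .inr (.inl ⟨rfl, rfl⟩)⟩
    · exact ⟨p, x, q, v, y, ⟨by omega, by omega, by omega, by omega, e1, e2, e3, e4, e5⟩,
        .inl ⟨rfl, rfl⟩⟩
  -- With no neighbour beyond $q$, the next edge in cyclic order goes to the least neighbour of $p$.
  · obtain ⟨v, hpv, hmin⟩ := Int.exists_least_of_bdd (P := fun v => A p v)
      ⟨p - 2 * n, fun z hz => by have := h.le_add (h.symm hz); omega⟩ ⟨q, hpq⟩
    have hv := hmin (p - 2) (h.symm (h.adj_of_le_two (by omega) (by omega)))
    obtain ⟨x, y, h1, h2, h3, h4, e1, e2, e3, e4, e5⟩ := h.exists_starAt_of_gt hpq hpv hlen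
      (by omega) hne fun t ht => ⟨hmin t ht, le_of_not_gt fun hc => hex ⟨t, hc, ht⟩⟩
    simp only [CutAt.lt_iff] at h1 h2 h3 h4
    exact ⟨v, y, p, x, q, ⟨by omega, by omega, by omega, by omega, h.symm e2, h.symm e3,
      h.symm e5, e1, h.symm e4⟩, .inr (.inr ⟨rfl, rfl⟩)⟩

end PeriodicMaximal

/-! ### Uniqueness of the star on each side of an edge. -/

section Unique

variable {A : ℤ → ℤ → Prop} {p q z₀ z₁ z₂ z₃ z₄ y₀ y₁ y₂ y₃ y₄ : ℤ}

theorem star_below_unique (symm : ∀ ⦃p q⦄, A p q → A q p) (hA : NoTripleCrossing A)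
    (hz : StarAt A z₀ z₁ z₂ z₃ z₄) (hy : StarAt A y₀ y₁ y₂ y₃ y₄)
    (hpz : (p = z₀ ∧ q = z₃) ∨ (p = z₁ ∧ q = z₄)) (hpy : (p = y₀ ∧ q = y₃) ∨ (p = y₁ ∧ q = y₄)) :
    z₀ = y₀ ∧ z₁ = y₁ ∧ z₂ = y₂ ∧ z₃ = y₃ ∧ z₄ = y₄ := by
  obtain ⟨x, w, y, hS, hz'⟩ : ∃ x w y, StarAt (lift A p) ⟨p⟩ ⟨x⟩ ⟨w⟩ ⟨q⟩ ⟨y⟩ ∧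
      ((p = z₀ ∧ x = z₁ ∧ w = z₂ ∧ q = z₃ ∧ y = z₄) ∨
        (p = z₁ ∧ x = z₂ ∧ w = z₃ ∧ q = z₄ ∧ y = z₀)) := by
    rcases hpz with ⟨rfl, rfl⟩ | ⟨rfl, rfl⟩
    · exact ⟨_, _, _, hz.cutAt_zero, .inl ⟨rfl, rfl, rfl, rfl, rfl⟩⟩
    · exact ⟨_, _, _, hz.cutAt_one symm, .inr ⟨rfl, rfl, rfl, rfl, rfl⟩⟩
  obtain ⟨x', w', y', hS', hy'⟩ : ∃ x w y, StarAt (lift A p) ⟨p⟩ ⟨x⟩ ⟨w⟩ ⟨q⟩ ⟨y⟩ ∧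
      ((p = y₀ ∧ x = y₁ ∧ w = y₂ ∧ q = y₃ ∧ y = y₄) ∨
        (p = y₁ ∧ x = y₂ ∧ w = y₃ ∧ q = y₄ ∧ y = y₀)) := by
    rcases hpy with ⟨rfl, rfl⟩ | ⟨rfl, rfl⟩
    · exact ⟨_, _, _, hy.cutAt_zero, .inl ⟨rfl, rfl, rfl, rfl, rfl⟩⟩
    · exact ⟨_, _, _, hy.cutAt_one symm, .inr ⟨rfl, rfl, rfl, rfl, rfl⟩⟩
  have heq := hS.unique_of_outer (CutAt.noTripleCrossing symm hA p) hS'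
  simp only [CutAt.mk.injEq] at heq
  have := hz.hux; have := hz.hxw; have := hz.hwv; have := hz.hvy
  have := hy.hux; have := hy.hxw; have := hy.hwv; have := hy.hvy
  omega

theorem star_above_unique (symm : ∀ ⦃p q⦄, A p q → A q p) (hA : NoTripleCrossing A)
    (hz : StarAt A z₀ z₁ z₂ z₃ z₄) (hy : StarAt A y₀ y₁ y₂ y₃ y₄)
    (hpz : (p = z₀ ∧ q = z₂) ∨ (p = z₁ ∧ q = z₃) ∨ (p = z₂ ∧ q = z₄))
    (hpy : (p = y₀ ∧ q = y₂) ∨ (p = y₁ ∧ q = y₃) ∨ (p = y₂ ∧ q = y₄)) :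
    z₀ = y₀ ∧ z₁ = y₁ ∧ z₂ = y₂ ∧ z₃ = y₃ ∧ z₄ = y₄ := by
  obtain ⟨x, v, y, hS, hz'⟩ : ∃ x v y, StarAt (lift A p) ⟨p⟩ ⟨x⟩ ⟨q⟩ ⟨v⟩ ⟨y⟩ ∧
      ((p = z₀ ∧ x = z₁ ∧ q = z₂ ∧ v = z₃ ∧ y = z₄) ∨
        (p = z₁ ∧ x = z₂ ∧ q = z₃ ∧ v = z₄ ∧ y = z₀) ∨
        (p = z₂ ∧ x = z₃ ∧ q = z₄ ∧ v = z₀ ∧ y = z₁)) := by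
    rcases hpz with ⟨rfl, rfl⟩ | ⟨rfl, rfl⟩ | ⟨rfl, rfl⟩
    · exact ⟨_, _, _, hz.cutAt_zero, .inl ⟨rfl, rfl, rfl, rfl, rfl⟩⟩
    · exact ⟨_, _, _, hz.cutAt_one symm, .inr (.inl ⟨rfl, rfl, rfl, rfl, rfl⟩)⟩
    · exact ⟨_, _, _, hz.cutAt_two symm, .inr (.inr ⟨rfl, rfl, rfl, rfl, rfl⟩)⟩
  obtain ⟨x', v', y', hS', hy'⟩ : ∃ x v y, StarAt (lift A p) ⟨p⟩ ⟨x⟩ ⟨q⟩ ⟨v⟩ ⟨y⟩ ∧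
      ((p = y₀ ∧ x = y₁ ∧ q = y₂ ∧ v = y₃ ∧ y = y₄) ∨
        (p = y₁ ∧ x = y₂ ∧ q = y₃ ∧ v = y₄ ∧ y = y₀) ∨
        (p = y₂ ∧ x = y₃ ∧ q = y₄ ∧ v = y₀ ∧ y = y₁)) := by
    rcases hpy with ⟨rfl, rfl⟩ | ⟨rfl, rfl⟩ | ⟨rfl, rfl⟩
    · exact ⟨_, _, _, hy.cutAt_zero, .inl ⟨rfl, rfl, rfl, rfl, rfl⟩⟩
    · exact ⟨_, _, _, hy.cutAt_one symm, .inr (.inl ⟨rfl, rfl, rfl, rfl, rfl⟩)⟩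
    · exact ⟨_, _, _, hy.cutAt_two symm, .inr (.inr ⟨rfl, rfl, rfl, rfl, rfl⟩)⟩
  have heq := hS.unique_of_inner (CutAt.noTripleCrossing symm hA p) hS'
  simp only [CutAt.mk.injEq] at heq
  have := hz.hux; have := hz.hxw; have := hz.hwv; have := hz.hvy
  have := hy.hux; have := hy.hxw; have := hy.hwv; have := hy.hvy
  omega

end Unique

/-! ### From edges and stars of the half-cylinder to the periodic relation. -/

theorem crossingFree_three_iff {B : Set CoverEdge} : CrossingFree 3 B ↔
    ∀ e ∈ B, ∀ f ∈ B, ∀ g ∈ B, e.lo < f.lo → f.lo < g.lo → g.lo < e.hi → e.hi < f.hi →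
      f.hi < g.hi → False := by
  classical
  constructor
  · intro hB e he f hf g hg h1 h2 h3 h4 h5
    refine hB {e, f, g} ?_ ⟨Finset.card_eq_three.2 ⟨e, f, g, ?_, ?_, ?_, rfl⟩, ?_⟩
    · simp [Set.insert_subset_iff, he, hf, hg]
    · rintro rfl; omega
    · rintro rfl; omega
    · rintro rfl; omega
    · intro a ha b hb hab
      simp only [Finset.coe_insert, Finset.coe_singleton, Set.mem_insert_iff,
        Set.mem_singleton_iff] at ha hb
      unfold CoverEdge.Crosses
      rcases ha with rfl | rfl | rfl <;> rcases hb with rfl | rfl | rfl <;>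
        first | exact (hab rfl).elim | omega
  · rintro hB E hE ⟨hcard, hcr⟩
    obtain ⟨e, f, g, hef, heg, hfg, rfl⟩ := Finset.card_eq_three.1 hcard
    simp only [Finset.coe_insert, Finset.coe_singleton, Set.insert_subset_iff,
      Set.singleton_subset_iff] at hE
    obtain ⟨he, hf, hg⟩ := hE
    have c1 := hcr (by simp) (by simp) hef
    have c2 := hcr (by simp) (by simp) heg
    have c3 := hcr (by simp) (by simp) hfg
    unfold CoverEdge.Crosses at c1 c2 c3
    rcases lt_or_ge e.lo f.lo with h1 | h1
    · rcases lt_or_ge f.lo g.lo with h2 | h2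
      · apply hB e he f hf g hg <;> omega
      · rcases lt_or_ge e.lo g.lo with h3 | h3
        · apply hB e he g hg f hf <;> omega
        · apply hB g hg e he f hf <;> omega
    · rcases lt_or_ge e.lo g.lo with h2 | h2
      · apply hB f hf e he g hg <;> omega
      · rcases lt_or_ge f.lo g.lo with h3 | h3
        · apply hB f hf g hg e he <;> omega
        · apply hB g hg f hf e he <;> omega

variable {n : ℕ}

theorem projEdge_eq_iff {e f : CoverEdge} :
    projEdge n e = projEdge n f ↔ ∃ l : ℤ, f = e.shift (l * n) :=
  Quotient.eq (r := CoverEdge.translationSetoid n)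

theorem projStar_eq_iff {S R : CoverStar 2} :
    projStar n S = projStar n R ↔ ∃ l : ℤ, R = S.shift (l * n) :=
  Quotient.eq (r := CoverStar.translationSetoid n 2)

theorem projEdge_shift (e : CoverEdge) (l : ℤ) : projEdge n (e.shift (l * n)) = projEdge n e :=
  (projEdge_eq_iff.2 ⟨l, rfl⟩).symm

theorem projStar_shift (S : CoverStar 2) (l : ℤ) : projStar n (S.shift (l * n)) = projStar n S :=
  (projStar_eq_iff.2 ⟨l, rfl⟩).symm

/-- Two marked points of the cover are joined by a lift of an edge in `T`. -/
def Adj (T : Set (Edge n)) (p q : ℤ) : Prop := ∃ e : CoverEdge, projEdge n e ∈ T ∧ e.Joins p q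

theorem adj_symm (T : Set (Edge n)) ⦃p q : ℤ⦄ (hpq : Adj T p q) : Adj T q p :=
  let ⟨e, he, h⟩ := hpq
  ⟨e, he, h.symm⟩

theorem projEdge_mem_of_joins {T : Set (Edge n)} {p q : ℤ} (hA : Adj T p q) {e : CoverEdge}
    (he : e.Joins p q) : projEdge n e ∈ T := by
  obtain ⟨f, hf, hJ⟩ := hA
  have := e.lo_lt_hi
  have := f.lo_lt_hi
  obtain rfl : e = f := by
    unfold CoverEdge.Joins at he hJ
    ext <;> omega
  exact hf

theorem adj_iff {T : Set (Edge n)} {e : CoverEdge} : Adj T e.lo e.hi ↔ projEdge n e ∈ T :=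
  ⟨fun h => projEdge_mem_of_joins h (.inl ⟨rfl, rfl⟩), fun h => ⟨e, h, .inl ⟨rfl, rfl⟩⟩⟩

theorem IsTriangulation.periodicMaximal {T : Set (Edge n)} (hn : 1 ≤ n)
    (hT : IsTriangulation n 2 T) : PeriodicMaximal n (Adj T) where
  pos := by exact_mod_cast hn
  symm := adj_symm T
  add_mul := by
    rintro p q l ⟨e, he, hJ⟩
    refine ⟨e.shift (l * n), by rwa [projEdge_shift], ?_⟩
    simp only [CoverEdge.Joins, CoverEdge.shift] at hJ ⊢
    omega
  noTriple := by
    intro a₁ a₂ a₃ b₁ b₂ b₃ h1 h2 h3 h4 h5 e1 e2 e3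
    exact crossingFree_three_iff.1 hT.prop ⟨a₁, b₁, by omega⟩
      (projEdge_mem_of_joins e1 (.inl ⟨rfl, rfl⟩)) ⟨a₂, b₂, by omega⟩
      (projEdge_mem_of_joins e2 (.inl ⟨rfl, rfl⟩)) ⟨a₃, b₃, by omega⟩
      (projEdge_mem_of_joins e3 (.inl ⟨rfl, rfl⟩)) h1 h2 h3 h4 h5
  maximal := by
    intro p q hpq hA hno
    refine hA (adj_iff (e := ⟨p, q, hpq⟩).2 ?_)
    refine hT.le_of_ge (y := insert (projEdge n ⟨p, q, hpq⟩) T) ?_ (Set.subset_insert _ _)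
      (Set.mem_insert _ _)
    refine crossingFree_three_iff.2 fun e he f hf g hg h1 h2 h3 h4 h5 => ?_
    have key : ∀ e : CoverEdge, projEdge n e ∈ insert (projEdge n ⟨p, q, hpq⟩) T →
        Adj T e.lo e.hi ∨ ∃ l : ℤ, e.lo = p + l * n ∧ e.hi = q + l * n := by
      rintro e (he | he)
      · obtain ⟨l, rfl⟩ := projEdge_eq_iff.1 he.symm
        exact .inr ⟨l, rfl, rfl⟩
      · exact .inl (adj_iff.2 he)
    exact hno h1 h2 h3 h4 h5 (key e he) (key f hf) (key g hg)

theorem projStar_edges_subset_iff {T : Set (Edge n)} {S : CoverStar 2} :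
    (projStar n S).edges ⊆ T ↔ StarAt (Adj T) (S.z 0) (S.z 1) (S.z 2) (S.z 3) (S.z 4) := by
  constructor
  · intro hS
    have key : ∀ (i j : Fin 5) (hij : i < j),
        (Fin.ofNat 5 (i + 2) = j ∨ Fin.ofNat 5 (j + 2) = i) → Adj T (S.z i) (S.z j) := by
      intro i j hij hJ
      refine adj_iff (e := ⟨S.z i, S.z j, S.strictMono hij⟩).2
        (hS ⟨S, rfl, _, ?_, rfl⟩)
      rcases hJ with hJ | hJ
      · exact ⟨i, .inl ⟨rfl, (congrArg S.z hJ).symm⟩⟩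
      · exact ⟨j, .inr ⟨(congrArg S.z hJ).symm, rfl⟩⟩
    exact ⟨S.strictMono (by decide), S.strictMono (by decide), S.strictMono (by decide),
      S.strictMono (by decide), key 0 2 (by decide) (by decide), key 0 3 (by decide) (by decide),
      key 1 3 (by decide) (by decide), key 2 4 (by decide) (by decide),
      key 1 4 (by decide) (by decide)⟩
  · rintro hS c ⟨R, hR, e, ⟨i, hJ⟩, rfl⟩
    obtain ⟨l, rfl⟩ := projStar_eq_iff.1 hR
    rw [← projEdge_shift e l]
    have hJ' : (e.shift (l * n)).Joins ((R.shift (l * n)).z i)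
        ((R.shift (l * n)).z (Fin.ofNat (2 * 2 + 1) (i + 2))) := by
      simp only [CoverEdge.Joins, CoverEdge.shift, CoverStar.shift] at hJ ⊢
      omega
    refine projEdge_mem_of_joins ?_ hJ'
    obtain ⟨-, -, -, -, e1, e2, e3, e4, e5⟩ := hS
    fin_cases i
    · exact e1
    · exact e3
    · exact e4
    · exact adj_symm T e2
    · exact adj_symm T e5

/-! ### Counting edges by the stars that contain them. -/

variable {n : ℕ}

/-- The edge of `C_n` joining the `i`-th and the `j`-th vertex of a star. -/
def Star.edge (s : Star n 2) (i j : Fin 5) (hij : i < j) : Edge n :=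
  Quotient.map' (s₁ := CoverStar.translationSetoid n 2) (s₂ := CoverEdge.translationSetoid n)
    (fun S => ⟨S.z i, S.z j, S.strictMono hij⟩) (by rintro S _ ⟨l, rfl⟩; exact ⟨l, rfl⟩) s

theorem length_projEdge (e : CoverEdge) : (projEdge n e).length = e.hi - e.lo := rfl

theorem Edge.length_pos (c : Edge n) : 0 < c.length := by
  induction c using Quotient.inductionOn with | _ e
  exact sub_pos.2 e.lo_lt_hi

/-- The stars of `C_n` contained in `T`. -/
def starsIn (T : Set (Edge n)) : Set (Star n 2) := {s | s.edges ⊆ T}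

theorem adj_of_starAt {T : Set (Edge n)} {S : CoverStar 2}
    (hS : StarAt (Adj T) (S.z 0) (S.z 1) (S.z 2) (S.z 3) (S.z 4)) {i j : Fin 5} (hij : i < j)
    (hJ : (i : ℕ) + 2 = j ∨ (i : ℕ) + 3 = j) : Adj T (S.z i) (S.z j) := by
  obtain ⟨-, -, -, -, e1, e2, e3, e4, e5⟩ := hS
  fin_cases i <;> fin_cases j <;> first | assumption | (simp at hJ)

/-- If every edge of a set `C` is, in exactly one way, the edge of a star in `T` at one of `k` given
positions, then `C` has `k` times as many elements as there are stars in `T`. -/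
theorem encard_eq_mul {k : ℕ} {T C : Set (Edge n)} (lo hi : Fin k → Fin 5)
    (hlt : ∀ i, lo i < hi i) (hlo : lo.Injective)
    (maps : ∀ S : CoverStar 2, StarAt (Adj T) (S.z 0) (S.z 1) (S.z 2) (S.z 3) (S.z 4) → ∀ i,
      projEdge n ⟨S.z (lo i), S.z (hi i), S.strictMono (hlt i)⟩ ∈ C)
    (inj : ∀ S R : CoverStar 2, StarAt (Adj T) (S.z 0) (S.z 1) (S.z 2) (S.z 3) (S.z 4) →
      StarAt (Adj T) (R.z 0) (R.z 1) (R.z 2) (R.z 3) (R.z 4) → ∀ i j,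
      S.z (lo i) = R.z (lo j) → S.z (hi i) = R.z (hi j) → S = R)
    (surj : ∀ e : CoverEdge, projEdge n e ∈ C → ∃ S : CoverStar 2,
      StarAt (Adj T) (S.z 0) (S.z 1) (S.z 2) (S.z 3) (S.z 4) ∧
        ∃ i, e.lo = S.z (lo i) ∧ e.hi = S.z (hi i)) :
    C.encard = (starsIn T).encard * k := by
  let F : Star n 2 × Fin k → Edge n := fun x => x.1.edge (lo x.2) (hi x.2) (hlt x.2)
  have hF : C = F '' (starsIn T ×ˢ Set.univ) := by
    ext c
    constructor
    · induction c using Quotient.inductionOn with | _ e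
      intro he
      obtain ⟨S, hS, i, h1, h2⟩ := surj e he
      refine ⟨(projStar n S, i), ⟨projStar_edges_subset_iff.2 hS, trivial⟩, ?_⟩
      exact congrArg (projEdge n) (CoverEdge.ext h1.symm h2.symm)
    · rintro ⟨⟨s, i⟩, ⟨hs, -⟩, rfl⟩
      induction s using Quotient.inductionOn with | _ S
      exact maps S (projStar_edges_subset_iff.1 hs) i
  have hinj : Set.InjOn F (starsIn T ×ˢ Set.univ) := by
    rintro ⟨s, i⟩ ⟨hs, -⟩ ⟨r, j⟩ ⟨hr, -⟩ heq
    induction s using Quotient.inductionOn with | _ S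
    induction r using Quotient.inductionOn with | _ R
    change projStar n S ∈ _ at hs
    obtain ⟨l, hl⟩ := projEdge_eq_iff.1 heq
    rw [← projStar_shift S l] at hs
    have h1 : (S.shift (l * n)).z (lo i) = R.z (lo j) := (congrArg CoverEdge.lo hl).symm
    have h2 : (S.shift (l * n)).z (hi i) = R.z (hi j) := (congrArg CoverEdge.hi hl).symm
    obtain rfl := inj (S.shift (l * n)) R (projStar_edges_subset_iff.1 hs)
      (projStar_edges_subset_iff.1 hr) i j h1 h2
    rw [hlo (CoverStar.strictMono _ |>.injective h1)]
    exact Prod.ext (projStar_shift S l).symm rfl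
  rw [hF, hinj.encard_image, Set.encard_prod, Set.encard_univ]
  simp

theorem encard_length_eq (hn : 1 ≤ n) {m : ℤ} (hm : 0 < m) :
    {c : Edge n | c.length = m}.encard = n := by
  let F : ℤ → Edge n := fun a => projEdge n ⟨a, a + m, by omega⟩
  have hF : {c : Edge n | c.length = m} = F '' (Finset.Ico (0 : ℤ) n : Set ℤ) := by
    ext c
    constructor
    · induction c using Quotient.inductionOn with | _ e
      intro he
      change e.hi - e.lo = m at he
      refine ⟨e.lo % n, by simp [Int.emod_nonneg, Int.emod_lt_of_pos, show n ≠ 0 by omega,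
        show 0 < n by omega], ?_⟩
      refine projEdge_eq_iff.2 ⟨e.lo / n, ?_⟩
      have := Int.emod_add_ediv_mul e.lo n
      ext <;> simp only [CoverEdge.shift] <;> omega
    · rintro ⟨a, -, rfl⟩
      simp [F, length_projEdge]
  have hinj : Set.InjOn F (Finset.Ico (0 : ℤ) n : Set ℤ) := by
    intro a ha b hb hab
    obtain ⟨l, hl⟩ := projEdge_eq_iff.1 hab
    have h1 : b = a + l * n := congrArg CoverEdge.lo hl
    simp only [Finset.coe_Ico, Set.mem_Ico] at ha hb
    have : b % n = a % n := by rw [h1]; simp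
    rwa [Int.emod_eq_of_lt hb.1 hb.2, Int.emod_eq_of_lt ha.1 ha.2, eq_comm] at this
  rw [hF, hinj.encard_image, Set.encard_coe_eq_coe_finsetCard]
  simp

section Count

variable {T : Set (Edge n)}

/-- Count through the star below each edge, in which the edge joins the vertices 0 and 3 or 1 and 4.
-/
theorem IsTriangulation.encard_relevant (hn : 1 ≤ n) (hT : IsTriangulation n 2 T) :
    {c | c ∈ T ∧ c.IsRelevant 2}.encard = (starsIn T).encard * 2 := by
  have hP := hT.periodicMaximal hn
  refine encard_eq_mul (k := 2) ![0, 1] ![3, 4] (by decide) (by decide) ?_ ?_ ?_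
  · intro S hS i
    have hA : Adj T (S.z (![0, 1] i)) (S.z (![3, 4] i)) :=
      adj_of_starAt hS (by fin_cases i <;> decide) (by fin_cases i <;> simp)
    refine ⟨projEdge_mem_of_joins hA (.inl ⟨rfl, rfl⟩), ?_⟩
    have h1 := hS.hux; have h2 := hS.hxw; have h3 := hS.hwv; have h4 := hS.hvy
    have h5 := hP.le_add hA
    rw [Edge.IsRelevant, length_projEdge]
    fin_cases i <;> simp at h5 ⊢ <;> omega
  · intro S R hS hR i j h1 h2
    have := star_below_unique (p := S.z (![0, 1] i)) (q := S.z (![3, 4] i)) hP.symm hP.noTriple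
      hS hR (by fin_cases i <;> simp) (by rw [h1, h2]; fin_cases j <;> simp)
    ext i
    fin_cases i <;> simp [this]
  · rintro e ⟨he, hrel⟩
    rw [Edge.IsRelevant, length_projEdge] at hrel
    obtain ⟨z₀, z₁, z₂, z₃, z₄, hS, hz⟩ := hP.exists_star_below (adj_iff.2 he) (by omega)
    refine ⟨⟨![z₀, z₁, z₂, z₃, z₄], ?_⟩, hS, ?_⟩
    · have h1 := hS.hux; have h2 := hS.hxw; have h3 := hS.hwv; have h4 := hS.hvy
      refine Fin.strictMono_iff_lt_succ.2 fun i => ?_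
      fin_cases i <;> assumption
    · rcases hz with hz | hz
      · exact ⟨0, hz⟩
      · exact ⟨1, hz⟩

/-- Count through the star above each edge, in which the edge joins the vertices 0 and 2, 1 and 3,
or 2 and 4. -/
theorem IsTriangulation.encard_two_le_length (hn : 1 ≤ n) (hT : IsTriangulation n 2 T) :
    {c | c ∈ T ∧ 2 ≤ c.length ∧ c.length ≠ 2 * n}.encard = (starsIn T).encard * 3 := by
  have hP := hT.periodicMaximal hn
  refine encard_eq_mul (k := 3) ![0, 1, 2] ![2, 3, 4] (by decide) (by decide) ?_ ?_ ?_
  · intro S hS i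
    have hA : Adj T (S.z (![0, 1, 2] i)) (S.z (![2, 3, 4] i)) :=
      adj_of_starAt hS (by fin_cases i <;> decide) (by fin_cases i <;> simp)
    refine ⟨projEdge_mem_of_joins hA (.inl ⟨rfl, rfl⟩), ?_⟩
    have h1 := hS.hux; have h2 := hS.hxw; have h3 := hS.hwv; have h4 := hS.hvy
    rw [length_projEdge]
    -- Each of the three edges is strictly shorter than $[z_0,z_3]$ or $[z_1,z_4]$, so its length is
    -- below $2n$.
    have h5 := hP.le_add hS.uv
    have h6 := hP.le_add hS.xy
    refine ⟨by fin_cases i <;> simp <;> omega, ?_⟩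
    fin_cases i <;> simp <;> omega
  · intro S R hS hR i j h1 h2
    have := star_above_unique (p := S.z (![0, 1, 2] i)) (q := S.z (![2, 3, 4] i)) hP.symm
      hP.noTriple hS hR (by fin_cases i <;> simp) (by rw [h1, h2]; fin_cases j <;> simp)
    ext i
    fin_cases i <;> simp [this]
  · rintro e ⟨he, hlen, hne⟩
    rw [length_projEdge] at hlen hne
    obtain ⟨z₀, z₁, z₂, z₃, z₄, hS, hz⟩ :=
      hP.exists_star_above (adj_iff.2 he) (by omega) (by omega)
    refine ⟨⟨![z₀, z₁, z₂, z₃, z₄], ?_⟩, hS, ?_⟩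
    · have h1 := hS.hux; have h2 := hS.hxw; have h3 := hS.hwv; have h4 := hS.hvy
      refine Fin.strictMono_iff_lt_succ.2 fun i => ?_
      fin_cases i <;> assumption
    · rcases hz with hz | hz | hz
      · exact ⟨0, hz⟩
      · exact ⟨1, hz⟩
      · exact ⟨2, hz⟩

theorem IsTriangulation.encard_length_eq_two_mul (hn : 1 ≤ n) (hT : IsTriangulation n 2 T) :
    {c | c ∈ T ∧ c.length = 2 * n}.encard = 1 := by
  have hP := hT.periodicMaximal hn
  obtain ⟨a, ha⟩ := hP.exists_adj_add_two_mul
  rw [Set.encard_eq_one]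
  refine ⟨projEdge n ⟨a, a + 2 * n, by omega⟩, Set.eq_singleton_iff_unique_mem.2
    ⟨⟨projEdge_mem_of_joins ha (.inl ⟨rfl, rfl⟩), ?_⟩, ?_⟩⟩
  · simp [length_projEdge]
  · intro c
    induction c using Quotient.inductionOn with | _ e
    rintro ⟨he, hlen⟩
    change e.hi - e.lo = 2 * n at hlen
    have hA := adj_iff.2 he
    rw [show e.hi = e.lo + 2 * n by omega] at hA
    obtain ⟨l, hl⟩ := hP.exists_eq_add_mul hA ha
    refine projEdge_eq_iff.2 ⟨l, ?_⟩
    ext <;> simp only [CoverEdge.shift] <;> omega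

theorem IsTriangulation.mem_of_length_le_two (hn : 1 ≤ n) (hT : IsTriangulation n 2 T)
    {c : Edge n} (hc : c.length ≤ 2) : c ∈ T := by
  induction c using Quotient.inductionOn with | _ e
  change e.hi - e.lo ≤ 2 at hc
  exact adj_iff.1 ((hT.periodicMaximal hn).adj_of_le_two e.lo_lt_hi (by omega))

theorem IsTriangulation.length_le (hn : 1 ≤ n) (hT : IsTriangulation n 2 T)
    {c : Edge n} (hc : c ∈ T) : c.length ≤ 2 * n := by
  induction c using Quotient.inductionOn with | _ e
  have := (hT.periodicMaximal hn).le_add (adj_iff.2 hc)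
  change e.hi - e.lo ≤ 2 * n
  omega

theorem IsTriangulation.finite (hn : 1 ≤ n) (hT : IsTriangulation n 2 T) : T.Finite := by
  refine Set.Finite.subset ((Set.finite_Ioc (0 : ℤ) (2 * n)).biUnion
    (t := fun m => {c : Edge n | c.length = m}) fun m hm => ?_) fun c hc => ?_
  · exact Set.finite_of_encard_eq_coe (encard_length_eq hn hm.1)
  · exact Set.mem_biUnion ⟨c.length_pos, hT.length_le hn hc⟩ rfl

end Count

end HalfCylinder

theorem mainTheorem7 (n : ℕ) (hn : 1 ≤ n) (T : Set (HalfCylinder.Edge n))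
    (hT : HalfCylinder.IsTriangulation n 2 T) :
    {s : HalfCylinder.Star n 2 | s.edges ⊆ T}.encard = ((n - 1 : ℕ) : ℕ∞) ∧
    {c : HalfCylinder.Edge n | c ∈ T ∧ c.IsRelevant 2}.encard = ((2 * (n - 1) : ℕ) : ℕ∞) ∧
    T.encard = ((2 * (2 * n - 1) : ℕ) : ℕ∞) := by
  have hrel := hT.encard_relevant hn
  have habove := hT.encard_two_le_length hn
  have hinf := hT.encard_length_eq_two_mul hn
  have hone := HalfCylinder.encard_length_eq (n := n) hn one_pos
  have htwo := HalfCylinder.encard_length_eq (n := n) hn two_pos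
  set rel := {c : HalfCylinder.Edge n | c ∈ T ∧ c.IsRelevant 2} with hrel_def
  set one := {c : HalfCylinder.Edge n | c.length = 1} with hone_def
  set two := {c : HalfCylinder.Edge n | c.length = 2} with htwo_def
  set above := {c : HalfCylinder.Edge n | c ∈ T ∧ 2 ≤ c.length ∧ c.length ≠ 2 * n} with habove_def
  set inf := {c : HalfCylinder.Edge n | c ∈ T ∧ c.length = 2 * n} with hinf_def
  -- Both sides are the edges of $T$ of length at least 2, since $T$ has all edges of length 2 and
  -- none longer than $2n$.
  have hunion : above ∪ inf = rel ∪ two := by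
    ext c
    have h1 := hT.mem_of_length_le_two hn (c := c)
    have h2 := hT.length_le hn (c := c)
    simp only [hrel_def, htwo_def, habove_def, hinf_def, HalfCylinder.Edge.IsRelevant,
      Set.mem_union, Set.mem_ofPred_eq]
    grind
  have htotal : T = (rel ∪ two) ∪ one := by
    ext c
    have h1 := hT.mem_of_length_le_two hn (c := c)
    have h2 := hT.length_le hn (c := c)
    have h3 := c.length_pos
    simp only [hrel_def, htwo_def, hone_def, HalfCylinder.Edge.IsRelevant,
      Set.mem_union, Set.mem_ofPred_eq]
    grind
  have d1 : Disjoint above inf := Set.disjoint_left.2 fun c hc hc' => hc.2.2 hc'.2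
  have d2 : Disjoint rel two := Set.disjoint_left.2 fun c hc hc' => by
    have h1 : (2 : ℤ) < c.length := hc.2.1
    have h2 : c.length = 2 := hc'
    omega
  have d3 : Disjoint (rel ∪ two) one := Set.disjoint_left.2 fun c hc hc' => by
    have h2 : c.length = 1 := hc'
    rcases hc with hc | hc
    · have h1 : (2 : ℤ) < c.length := hc.2.1
      omega
    · have h1 : c.length = 2 := hc
      omega
  have hcount : (HalfCylinder.starsIn T).encard * 3 + 1 =
      (HalfCylinder.starsIn T).encard * 2 + n := by
    rw [← habove, ← hinf, ← Set.encard_union_eq d1, hunion, Set.encard_union_eq d2, hrel, htwo]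
  -- Finiteness is needed to cancel $2s$ from $3s+1=2s+n$ in `ℕ∞`.
  have hfin : (HalfCylinder.starsIn T).encard ≠ ⊤ := by
    intro htop
    have : rel.Finite := (hT.finite hn).subset fun c hc => hc.1
    rw [htop] at hrel
    exact this.encard_lt_top.ne (by rw [hrel]; rfl)
  obtain ⟨s, hs⟩ := ENat.ne_top_iff_exists.1 hfin
  have hTcard : T.encard = rel.encard + two.encard + one.encard := by
    conv_lhs => rw [htotal]
    rw [Set.encard_union_eq d3, Set.encard_union_eq d2]
  rw [← hs] at hcount hrel
  have hsn : s = n - 1 := by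
    have : s * 3 + 1 = s * 2 + n := by exact_mod_cast hcount
    omega
  have hrel' : rel.encard = ((2 * (n - 1) : ℕ) : ℕ∞) := by
    rw [hrel, hsn, mul_comm]
    push_cast
    rfl
  refine ⟨?_, hrel', ?_⟩
  · rw [← hsn, hs]
    rfl
  · rw [hTcard, hrel', htwo, hone]
    norm_cast
    omega
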